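/- Let $\mathcal H_1,\dots,\mathcal H_m$ be separable real Hilbert spaces and let $\mathcal H=\mathcal H_1\times\cdots\times\mathcal H_m$ be their Hilbert product. Let $T:\mathcal H\to\mathcal H$ be nonexpansive, $\|Tx-Ty\|\le\|x-y\|$ for all $x,y$, with $\operatorname{Fix}T=\{x: Tx=x\}\neq\emptyset$. Put $S=I-T$ and $S_ix=(0,\dots,0,(Sx)_i,0,\dots,0)$. Let $p_1,\dots,p_m>0$ with $\sum_i p_i=1$, let $p_{\min}=\min_i p_i$, let $\tau\ge 0$ be an integer, $0<c<1$, $\eta_{\min}>0$, and let $(\eta_k)_{k\ge0}$ be real numbers with $$\eta_k\in\Big[\eta_{\min},\ \frac{c\,m\,p_{\min}}{2\tau\sqrt{p_{\min}}+1}\Big]\qquad\text{for all }k\ge0.$$ On a probability space $(\Omega,\mathcal F,P)$ let $(x^k)_{k\ge 0}$ be generated by ARock with maximal delay $\tau$. That is, $x^k$ and $\hat x^k$ are $\mathcal H$-valued random variables and $i_k$ are $\{1,\dots,m\}$-valued random variables such that for every $k\ge0$: * (update) $x^{k+1}=x^k-\dfrac{\eta_k}{m\,p_{i_k}}\,S_{i_k}\hat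 x^k$; * (delayed, possibly inconsistent read) $\hat x^k=x^k+\sum_{d\in J(k)}(x^d-x^{d+1})$ for some, possibly random, set $J(k)\subseteq\{k-1,\dots,k-\tau\}$, where $x^j:=x^0$ for $j<0$; * (random selection) $P(i_k=i\mid\mathcal X^k)=p_i$ almost surely for every $i$, where $\mathcal X^k=\sigma(x^0,\hat x^1,x^1,\dots,\hat x^k,x^k)$. Let $\mathbf x^k=(x^k,x^{k-1},\dots,x^{k-\tau})\in\mathcal H^{\tau+1}$ and $\mathbf X^*=\{(x^*,\dots,x^*): x^*\in\operatorname{Fix}T\}\subseteq\mathcal H^{\tau+1}$. Then, almost surely, $(\mathbf x^k)_{k\ge0}$ converges weakly in $\mathcal H^{\tau+1}$ to an $\mathbf X^*$-valued random variable. If in addition $T$ is demicompact at $0$ (every bounded sequence $(u^k)_{k\ge 0}$ in $\mathcal H$ with $Tu^k-u^k\to0$ has a strongly convergent subsequence), then, almost surely, $(\mathbf x^k)_{k\ge0}$ converges strongly to an $\mathbf X^*$-valued random variable. -/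

import Mathlib

open Filter Topology MeasureTheory ProbabilityTheory

namespace ARock

noncomputable section

/-- The Hilbert space `H = H₁ × ⋯ × H_m` with the inner product `∑ i, ⟪x i, y i⟫`. -/
abbrev Space {m : ℕ} (E : Fin m → Type*) : Type _ := PiLp 2 E

/-- The product space `H^(τ+1)` with the inner product `∑ j, ⟪z j, y j⟫`. -/
abbrev Stack (H : Type*) (τ : ℕ) : Type _ := PiLp 2 (fun _ : Fin (τ + 1) => H)

/-- `T` is demicompact at `a`: every bounded sequence `u` with `T (u k) - u k → a` (strongly) has a
strongly convergent subsequence. -/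
def DemicompactAt {H : Type*} [NormedAddCommGroup H] (T : H → H) (a : H) : Prop :=
  ∀ u : ℕ → H, Bornology.IsBounded (Set.range u) →
    Tendsto (fun k => T (u k) - u k) atTop (𝓝 a) →
    ∃ (φ : ℕ → ℕ) (l : H), StrictMono φ ∧ Tendsto (u ∘ φ) atTop (𝓝 l)

/-- The set `𝐗* = {(x*, …, x*) | x* ∈ Fix T} ⊆ H^(τ+1)`. -/
def diagFix {H : Type*} (T : H → H) (τ : ℕ) : Set (Stack H τ) :=
  {z | ∃ xs : H, T xs = xs ∧ ∀ j, z j = xs}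

/-- The stacked iterate `𝐱^k = (x^k, x^(k-1), …, x^(k-τ))`, with `x^j = x^0` for `j < 0`
(natural-number subtraction truncates at `0`). -/
def stack {H : Type*} (τ : ℕ) (x : ℕ → H) (k : ℕ) : Stack H τ :=
  WithLp.toLp 2 (fun j : Fin (τ + 1) => x (k - (j : ℕ)))

/-- Weak convergence of a sequence in a real normed space. -/
def WeaklyTendsto {V : Type*} [NormedAddCommGroup V] [NormedSpace ℝ V] (z : ℕ → V) (l : V) : Prop :=
  Tendsto (fun k => toWeakSpace ℝ V (z k)) atTop (𝓝 (toWeakSpace ℝ V l))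

section Algorithm

variable {m : ℕ} {E : Fin m → Type*} [∀ i, NormedAddCommGroup (E i)]
  [∀ i, InnerProductSpace ℝ (E i)]

/-- `S_i x = (0, …, 0, (S x)_i, 0, …, 0)` where `S = I - T`. -/
def coordS (T : Space E → Space E) (i : Fin m) (x : Space E) : Space E :=
  WithLp.toLp 2 (Pi.single i ((x - T x) i))

/-- The smallest selection probability `p_min = min_i p_i`. -/
def pmin (p : Fin m → ℝ) : ℝ := ⨅ i, p i

variable {Ω : Type*} [MeasurableSpace Ω] [∀ i, MeasurableSpace (E i)]

/-- The sigma-algebra `𝒳^k` on `Ω` generated by the iterates `x^0, …, x^k` and the reads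
`xhat^0, …, xhat^k` (in a run of the algorithm `xhat^0 = x^0`). -/
abbrev history (x xhat : ℕ → Ω → Space E) (k : ℕ) : MeasurableSpace Ω :=
  ⨆ j ∈ Finset.range (k + 1),
    MeasurableSpace.comap (x j) inferInstance ⊔ MeasurableSpace.comap (xhat j) inferInstance

/-- `IsRun T p η τ P idx x xhat`: on the probability space `(Ω, P)`, the iterates `x^k` are generated
by ARock with operator `T`, selection probabilities `p`, step sizes `η` and maximal delay `τ`, where
`idx k` is the random coordinate selected at step `k` and `xhat^k` is the (possibly inconsistent)
read of `x` to which `S_{idx k}` is applied. -/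
structure IsRun (T : Space E → Space E) (p : Fin m → ℝ) (η : ℕ → ℝ) (τ : ℕ) (P : Measure Ω)
    (idx : ℕ → Ω → Fin m) (x xhat : ℕ → Ω → Space E) : Prop where
  measurable_idx : ∀ k, Measurable (idx k)
  measurable_iterate : ∀ k, Measurable (x k)
  measurable_read : ∀ k, Measurable (xhat k)
  /-- `xhat^k = x^k + ∑_{d ∈ J(k)} (x^d - x^(d+1))` with `J(k) ⊆ {k-1, …, k-τ}`, where the set
  `J(k)` may depend on `ω`. Negative `d` are left out: they contribute `x^0 - x^0 = 0`. -/
  read : ∀ k ω, ∃ J : Finset ℕ, J ⊆ Finset.Ico (k - τ) k ∧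
    xhat k ω = x k ω + ∑ d ∈ J, (x d ω - x (d + 1) ω)
  /-- `x^(k+1) = x^k - η_k / (m p_{i_k}) S_{i_k} xhat^k`. -/
  update : ∀ k ω, x (k + 1) ω =
    x k ω - (η k / ((m : ℝ) * p (idx k ω))) • coordS T (idx k ω) (xhat k ω)
  /-- `Prob(i_k = i | 𝒳^k) = p_i` almost surely. -/
  select : ∀ k i, P⟦idx k ⁻¹' {i} | history x xhat k⟧ =ᵐ[P] fun _ => p i

end Algorithm

end

end ARock

/-! Fix a fixed point `a` and put `r = √p_min`, `B = η_k / m`, `s = S xhat^k`. The Lyapunov function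
is `‖x^k - a‖² + r * delayEnergy`, where the second term stores recent squared steps to pay for
stale reads. In conditional mean, one coordinate step changes the squared distance by `-2B⟪x^k - a,
s⟫` plus the mean squared step, at most `B² / p_min * ‖s‖²`. Replacing `x^k` by `xhat^k` lets
cocoercivity of `I - T` give `-B‖s‖²`; the error is a sum of at most `τ` inner products, split by
Young's inequality between the stored energy and `‖s‖²`. The step-size bound leaves a net decrease
of at least `(1 - c) B ‖s‖²` (`lyapunov_mean_decrease`). Supermartingale convergence then gives,
almost surely, a limit of the Lyapunov function and `∑ ‖S xhat^k‖² < ∞` (`IsRun.ae_lyapunov`). Hence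
steps and delay energy vanish, the residual at `x^k` vanishes, and the distance to `a` converges. A
countable dense set of fixed points provides one null set for all `a` (`IsRun.ae_fejer`). Opial's
argument yields the weak limit; demicompactness upgrades it to a strong one. -/

namespace ARock

/-! ### Weak convergence, Opial's argument and measurability in Hilbert space. -/

section Hilbert

variable {H : Type*} [NormedAddCommGroup H] [InnerProductSpace ℝ H]

/-- Bounded sequences in a Hilbert space converge weakly along every ultrafilter. -/
theorem exists_weak_limit_ultrafilter [CompleteSpace H] {x : ℕ → H} {C : ℝ} (hx : ∀ n, ‖x n‖ ≤ C)
    (U : Ultrafilter ℕ) :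
    ∃ z, ∀ y, Tendsto (fun n => inner ℝ (x n) y) U (𝓝 (inner ℝ z y)) := by
  set D := InnerProductSpace.toDual ℝ H
  -- Banach–Alaoglu, transported through the Riesz isomorphism.
  have hcomp := WeakDual.isCompact_closedBall (𝕜 := ℝ) (E := H) 0 C
  obtain ⟨w, -, hw⟩ := hcomp.ultrafilter_le_nhds
    (U.map fun n => StrongDual.toWeakDual (D (x n))) (by
      rw [Ultrafilter.coe_map, le_principal_iff, mem_map]
      refine univ_mem' fun n => ?_
      simpa [D] using hx n)
  refine ⟨D.symm (WeakDual.toStrongDual w), fun y => ?_⟩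
  have h := (tendsto_iff_forall_eval_tendsto_topDualPairing
    (f := fun n => StrongDual.toWeakDual (D (x n)))).1 hw y
  change Tendsto (fun n => D (x n) y) U (𝓝 (WeakDual.toStrongDual w y)) at h
  simpa [D, ← InnerProductSpace.toDual_symm_apply] using h

/-- Demiclosedness principle for nonexpansive maps, along an arbitrary nontrivial filter. -/
theorem fixed_of_weak_limit {T : H → H} (hT : LipschitzWith 1 T) {x : ℕ → H} {C : ℝ}
    (hx : ∀ n, ‖x n‖ ≤ C) {l : Filter ℕ} [l.NeBot]
    (hres : Tendsto (fun n => x n - T (x n)) l (𝓝 0)) {z : H}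
    (hz : ∀ y, Tendsto (fun n => inner ℝ (x n) y) l (𝓝 (inner ℝ z y))) : T z = z := by
  -- Expanding `‖x n - T z‖²` around `z` produces `‖z - T z‖²`, while nonexpansiveness bounds `‖x n
  -- - T z‖` by `‖x n - z‖` plus the residual; the terms `‖x n - z‖²` cancel.
  have hbound : ∀ n, ‖z - T z‖ ^ 2 ≤ ‖x n - T (x n)‖ * (2 * (C + ‖z‖) + ‖x n - T (x n)‖)
      - 2 * (inner ℝ (x n) (z - T z) - inner ℝ z (z - T z)) := by
    intro n
    have h1 : ‖x n - T z‖ ≤ ‖x n - T (x n)‖ + ‖x n - z‖ := by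
      have := hT.norm_sub_le (x n) z
      calc ‖x n - T z‖ = ‖(x n - T (x n)) + (T (x n) - T z)‖ := by congr 1; abel
        _ ≤ ‖x n - T (x n)‖ + ‖T (x n) - T z‖ := norm_add_le _ _
        _ ≤ _ := by simpa using this
    have h2 : ‖x n - T z‖ ^ 2 = ‖x n - z‖ ^ 2 + 2 * inner ℝ (x n - z) (z - T z) + ‖z - T z‖ ^ 2 := by
      rw [← norm_add_sq_real]; congr 2; abel
    rw [inner_sub_left] at h2
    have h3 : ‖x n - z‖ ≤ C + ‖z‖ := (norm_sub_le _ _).trans (by gcongr; exact hx n)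
    have h4 : ‖x n - T z‖ ^ 2 ≤ (‖x n - T (x n)‖ + ‖x n - z‖) ^ 2 := by gcongr
    nlinarith [mul_le_mul_of_nonneg_left h3 (norm_nonneg (x n - T (x n)))]
  have hlim : Tendsto (fun n => ‖x n - T (x n)‖ * (2 * (C + ‖z‖) + ‖x n - T (x n)‖)
      - 2 * (inner ℝ (x n) (z - T z) - inner ℝ z (z - T z))) l (𝓝 0) := by
    have hr := hres.norm
    rw [norm_zero] at hr
    have := (hr.mul (hr.const_add (2 * (C + ‖z‖)))).sub
      (((hz (z - T z)).sub_const (inner ℝ z (z - T z))).const_mul 2)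
    simpa using this
  have h0 : ‖z - T z‖ ^ 2 ≤ 0 := ge_of_tendsto' hlim hbound
  have : ‖z - T z‖ = 0 := by nlinarith [norm_nonneg (z - T z)]
  exact (sub_eq_zero.1 (norm_eq_zero.1 this)).symm

/-- Convergence of the distances to the points of a set extends to the closure of that set. -/
theorem exists_tendsto_norm_sub_of_mem_closure {H : Type*} [NormedAddCommGroup H] {x : ℕ → H} {D : Set H}
    (hD : ∀ a ∈ D, ∃ l, Tendsto (fun n => ‖x n - a‖) atTop (𝓝 l)) {a : H} (ha : a ∈ closure D) :
    ∃ l, Tendsto (fun n => ‖x n - a‖) atTop (𝓝 l) := by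
  refine cauchySeq_tendsto_of_complete (Metric.cauchySeq_iff'.2 fun ε hε => ?_)
  obtain ⟨b, hb, hab⟩ := Metric.mem_closure_iff.1 ha (ε / 3) (by positivity)
  obtain ⟨l, hl⟩ := hD b hb
  obtain ⟨N, hN⟩ := Metric.cauchySeq_iff'.1 hl.cauchySeq (ε / 3) (by positivity)
  refine ⟨N, fun n hn => ?_⟩
  have h1 := hN n hn
  have key : ∀ k, |‖x k - a‖ - ‖x k - b‖| ≤ dist a b := fun k => by
    refine (abs_norm_sub_norm_le _ _).trans (le_of_eq ?_)
    rw [sub_sub_sub_cancel_left, dist_comm, dist_eq_norm]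
  have h2 := abs_le.1 (key n)
  have h3 := abs_le.1 (key N)
  rw [Real.dist_eq, abs_lt] at h1 ⊢
  constructor <;> linarith

/-- Opial's lemma for a nonexpansive map: asymptotic regularity and convergence of the distances to
all fixed points imply weak convergence to a fixed point. -/
theorem exists_weak_limit_of_fejer [CompleteSpace H] {T : H → H} (hT : LipschitzWith 1 T)
    (hfix : ∃ a, T a = a) {x : ℕ → H} (hres : Tendsto (fun n => x n - T (x n)) atTop (𝓝 0))
    (hdist : ∀ a, T a = a → ∃ l, Tendsto (fun n => ‖x n - a‖) atTop (𝓝 l)) :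
    (∃ C, ∀ n, ‖x n‖ ≤ C) ∧
    ∃ z, T z = z ∧ ∀ y, Tendsto (fun n => inner ℝ (x n) y) atTop (𝓝 (inner ℝ z y)) := by
  obtain ⟨a, ha⟩ := hfix
  obtain ⟨C, hC⟩ : ∃ C, ∀ n, ‖x n‖ ≤ C := by
    obtain ⟨l, hl⟩ := hdist a ha
    obtain ⟨B, hB⟩ := hl.bddAbove_range
    refine ⟨B + ‖a‖, fun n => ?_⟩
    have h1 : ‖x n - a‖ ≤ B := hB ⟨n, rfl⟩
    have h2 := norm_le_norm_sub_add (x n) a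
    linarith
  refine ⟨⟨C, hC⟩, ?_⟩
  have cluster : ∀ U : Ultrafilter ℕ, (U : Filter ℕ) ≤ atTop → ∃ z, T z = z ∧
      ∀ y, Tendsto (fun n => inner ℝ (x n) y) U (𝓝 (inner ℝ z y)) := by
    intro U hU
    obtain ⟨z, hz⟩ := exists_weak_limit_ultrafilter hC U
    exact ⟨z, fixed_of_weak_limit hT hC (hres.mono_left hU) hz, hz⟩
  obtain ⟨z, hz, hzlim⟩ := cluster (hyperfilter ℕ) Nat.hyperfilter_le_atTop
  refine ⟨z, hz, fun y => ?_⟩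
  rw [tendsto_iff_ultrafilter]
  intro U hU
  obtain ⟨w, hw, hwlim⟩ := cluster U hU
  suffices h : w = z by simpa [h] using hwlim y
  obtain ⟨lz, hlz⟩ := hdist z hz
  obtain ⟨lw, hlw⟩ := hdist w hw
  -- By polarization this inner product depends only on the two convergent distances, so it has the
  -- same limit along every ultrafilter; this forces `⟪w, w - z⟫ = ⟪z, w - z⟫`.
  have hid : ∀ n, inner ℝ (x n) (w - z) =
      (‖x n - z‖ ^ 2 - ‖x n - w‖ ^ 2 - ‖z‖ ^ 2 + ‖w‖ ^ 2) / 2 := by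
    intro n
    rw [norm_sub_sq_real, norm_sub_sq_real, inner_sub_right]; ring
  have hlim : Tendsto (fun n => inner ℝ (x n) (w - z)) atTop
      (𝓝 ((lz ^ 2 - lw ^ 2 - ‖z‖ ^ 2 + ‖w‖ ^ 2) / 2)) := by
    simp_rw [hid]
    exact (((((hlz.pow 2).sub (hlw.pow 2)).sub_const _).add_const _).div_const _)
  have e1 := tendsto_nhds_unique (hlim.mono_left hU) (hwlim (w - z))
  have e2 := tendsto_nhds_unique (hlim.mono_left Nat.hyperfilter_le_atTop) (hzlim (w - z))
  have e3 : inner ℝ (w - z) (w - z) = 0 := by rw [inner_sub_left]; linarith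
  exact sub_eq_zero.1 (inner_self_eq_zero.1 e3)

/-- Under demicompactness at `0`, the weak limit in Opial's lemma is a strong limit. -/
theorem tendsto_of_weak_limit_of_demicompactAt {T : H → H} (hdemi : DemicompactAt T 0) {x : ℕ → H} {C : ℝ} (hC : ∀ n, ‖x n‖ ≤ C)
    (hres : Tendsto (fun n => x n - T (x n)) atTop (𝓝 0))
    (hdist : ∀ a, T a = a → ∃ l, Tendsto (fun n => ‖x n - a‖) atTop (𝓝 l)) {z : H}
    (hz : T z = z) (hzlim : ∀ y, Tendsto (fun n => inner ℝ (x n) y) atTop (𝓝 (inner ℝ z y))) :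
    Tendsto x atTop (𝓝 z) := by
  obtain ⟨φ, l, hφ, hl⟩ := hdemi x
    (isBounded_iff_forall_norm_le.2 ⟨C, by rintro _ ⟨n, rfl⟩; exact hC n⟩)
    (by simpa using hres.neg)
  have hlz : l = z := by
    refine ext_inner_right ℝ fun y => ?_
    have h1 : Tendsto (fun n => inner ℝ (x (φ n)) y) atTop (𝓝 (inner ℝ l y)) :=
      hl.inner tendsto_const_nhds
    exact tendsto_nhds_unique h1 ((hzlim y).comp hφ.tendsto_atTop)
  subst hlz
  obtain ⟨d, hd⟩ := hdist l hz
  have h0 : Tendsto (fun n => ‖x (φ n) - l‖) atTop (𝓝 0) := tendsto_iff_norm_sub_tendsto_zero.1 hl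
  have hd0 : d = 0 := tendsto_nhds_unique (hd.comp hφ.tendsto_atTop) h0
  exact tendsto_iff_norm_sub_tendsto_zero.2 (hd0 ▸ hd)

/-- Weak measurability implies measurability in a separable Hilbert space. -/
theorem measurable_of_inner [TopologicalSpace.SeparableSpace H] [MeasurableSpace H] [BorelSpace H]
    {Ω : Type*} [MeasurableSpace Ω] {f : Ω → H}
    (hf : ∀ y, Measurable fun ω => (inner ℝ (f ω) y : ℝ)) : Measurable f := by
  have : SecondCountableTopology H := UniformSpace.secondCountable_of_separable H
  have hnorm : ∀ a : H, Measurable fun ω => ‖f ω - a‖ := by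
    intro a
    refine measurable_of_Iic fun r => ?_
    rcases lt_or_ge r 0 with hr | hr
    · convert! MeasurableSet.empty
      ext ω
      simpa using hr.trans_le (norm_nonneg (f ω - a))
    -- A norm bound is a family of inner-product bounds, and by density countably many of them
    -- suffice.
    have : (fun ω => ‖f ω - a‖) ⁻¹' Set.Iic r = ⋂ n, {ω | inner ℝ (f ω)
        (TopologicalSpace.denseSeq H n) - inner ℝ a (TopologicalSpace.denseSeq H n)
          ≤ r * ‖TopologicalSpace.denseSeq H n‖} := by
      ext ω
      simp only [Set.mem_preimage, Set.mem_Iic, Set.mem_iInter, Set.mem_ofPred_eq, ← inner_sub_left]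
      refine ⟨fun h n => (real_inner_le_norm _ _).trans (by gcongr), fun h => ?_⟩
      have hall : ∀ y : H, inner ℝ (f ω - a) y ≤ r * ‖y‖ := by
        intro y
        have hcl : IsClosed {y : H | inner ℝ (f ω - a) y ≤ r * ‖y‖} :=
          isClosed_le (by fun_prop) (by fun_prop)
        exact (TopologicalSpace.denseRange_denseSeq H).induction_on y hcl h
      have h1 := hall (f ω - a)
      rw [real_inner_self_eq_norm_sq] at h1
      rcases (norm_nonneg (f ω - a)).eq_or_lt with h0 | h0
      · rwa [← h0]
      · nlinarith
    rw [this]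
    exact MeasurableSet.iInter fun n => measurableSet_le ((hf _).sub_const _) measurable_const
  refine measurable_of_isOpen fun s hs => ?_
  choose! ε hε hball using Metric.isOpen_iff.1 hs
  obtain ⟨t, hts, htc, hst⟩ := TopologicalSpace.countable_cover_nhdsWithin
    (f := fun a => Metric.ball a (ε a)) (s := s)
    fun a ha => mem_nhdsWithin_of_mem_nhds (Metric.ball_mem_nhds a (hε a ha))
  have : f ⁻¹' s = ⋃ a ∈ t, {ω | ‖f ω - a‖ < ε a} := by
    ext ω
    simp only [Set.mem_preimage, Set.mem_iUnion, Set.mem_ofPred_eq]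
    constructor
    · intro h
      simpa [dist_eq_norm] using hst h
    · rintro ⟨a, ha, h⟩
      exact hball a (hts ha) (by simpa [dist_eq_norm] using h)
  rw [this]
  exact MeasurableSet.biUnion htc fun a _ => measurableSet_lt (hnorm a) measurable_const

/-- Weak convergence of the iterates carries over to the stacked iterates. -/
theorem weaklyTendsto_stack [CompleteSpace H] (τ : ℕ) {x : ℕ → H} {z : H}
    (hz : ∀ y, Tendsto (fun n => inner ℝ (x n) y) atTop (𝓝 (inner ℝ z y))) :
    WeaklyTendsto (fun k => stack τ x k) (WithLp.toLp 2 fun _ => z) := by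
  refine (WeakBilin.tendsto_iff_forall_eval_tendsto
    (topDualPairing ℝ (Stack H τ)).flip ?_).2 fun g => ?_
  · exact fun a b hab => (SeparatingDual.eq_iff_forall_dual_eq (R := ℝ)).2 fun g => by
      simpa using congrArg (fun q => q g) hab
  · have hg : ∀ v : Stack H τ, g v = inner ℝ v ((InnerProductSpace.toDual ℝ _).symm g) := by
      intro v
      rw [real_inner_comm, InnerProductSpace.toDual_symm_apply]
    change Tendsto (fun k => g (stack τ x k)) atTop (𝓝 (g (WithLp.toLp 2 fun _ => z)))
    simp_rw [hg, PiLp.inner_apply]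
    exact tendsto_finsetSum _ fun j _ => (hz _).comp (tendsto_sub_atTop_nat (j : ℕ))

/-- Strong convergence of the iterates carries over to the stacked iterates. -/
theorem tendsto_stack {H : Type*} [NormedAddCommGroup H] (τ : ℕ) {x : ℕ → H} {z : H} (hz : Tendsto x atTop (𝓝 z)) :
    Tendsto (fun k => stack τ x k) atTop (𝓝 (WithLp.toLp 2 fun _ => z)) :=
  ((PiLp.continuous_toLp 2 _).tendsto _).comp
    (tendsto_pi_nhds.2 fun j => hz.comp (tendsto_sub_atTop_nat (j : ℕ)))

end Hilbert

/-! ### Supermartingale convergence and conditional selection. -/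

section Stochastic

variable {Ω : Type*} {mΩ : MeasurableSpace Ω} {μ : Measure Ω} [IsFiniteMeasure μ]

/-- A nonnegative process that decreases in conditional mean by at least `D k` at step `k`, with
`D k ≥ 0`, converges almost surely, and `∑ D k` is almost surely finite. -/
theorem ae_tendsto_and_summable_of_setIntegral_add_le {ℱ : Filtration ℕ mΩ} {Y D : ℕ → Ω → ℝ}
    (hYm : ∀ k, Measurable[ℱ k] (Y k)) (hDm : ∀ k, Measurable[ℱ k] (D k))
    (hYi : ∀ k, Integrable (Y k) μ) (hDi : ∀ k, Integrable (D k) μ)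
    (hY0 : ∀ k ω, 0 ≤ Y k ω) (hD0 : ∀ k ω, 0 ≤ D k ω)
    (hstep : ∀ k s, MeasurableSet[ℱ k] s →
      ∫ ω in s, Y (k + 1) ω ∂μ + ∫ ω in s, D k ω ∂μ ≤ ∫ ω in s, Y k ω ∂μ) :
    ∀ᵐ ω ∂μ, (∃ l, Tendsto (fun k => Y k ω) atTop (𝓝 l)) ∧ Summable fun k => D k ω := by
  -- Adding back the past decreases gives a nonnegative supermartingale. Since `Y ≥ 0`, its
  -- convergence bounds the partial sums of `D`.
  set Z : ℕ → Ω → ℝ := fun k ω => Y k ω + ∑ j ∈ Finset.range k, D j ω with hZ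
  have hZi : ∀ k, Integrable (Z k) μ := fun k =>
    (hYi k).add (integrable_finsetSum _ fun j _ => hDi j)
  have hZm : ∀ k, Measurable[ℱ k] (Z k) := fun k =>
    (hYm k).add (Finset.measurable_fun_sum _ fun j hj =>
      (hDm j).mono (ℱ.mono (Finset.mem_range.1 hj).le) le_rfl)
  have hZ0 : ∀ k ω, 0 ≤ Z k ω := fun k ω =>
    add_nonneg (hY0 k ω) (Finset.sum_nonneg fun j _ => hD0 j ω)
  have hZsup : Supermartingale Z ℱ μ := by
    refine supermartingale_of_setIntegral_succ_le (fun k => (hZm k).stronglyMeasurable) hZi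
      fun k s hs => ?_
    have e1 : ∫ ω in s, Z (k + 1) ω ∂μ = ∫ ω in s, Y (k + 1) ω ∂μ + (∫ ω in s, D k ω ∂μ +
        ∫ ω in s, ∑ j ∈ Finset.range k, D j ω ∂μ) := by
      have hS : Integrable (fun ω => ∑ j ∈ Finset.range k, D j ω) (μ.restrict s) :=
        integrable_finsetSum _ fun j _ => (hDi j).integrableOn
      have hDk : Integrable (fun ω => D k ω) (μ.restrict s) := (hDi k).integrableOn
      have hDS : Integrable (fun ω => D k ω + ∑ j ∈ Finset.range k, D j ω) (μ.restrict s) :=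
        hDk.add hS
      rw [← integral_add hDk hS, ← integral_add (hYi (k + 1)).integrableOn hDS]
      refine integral_congr_ae (ae_of_all _ fun ω => ?_)
      simp only [hZ, Finset.sum_range_succ]
      ring
    have e2 : ∫ ω in s, Z k ω ∂μ = ∫ ω in s, Y k ω ∂μ +
        ∫ ω in s, ∑ j ∈ Finset.range k, D j ω ∂μ :=
      integral_add (hYi k).integrableOn (integrable_finsetSum _ fun j _ => (hDi j).integrableOn)
    linarith [hstep k s hs]
  have hint : ∀ k, ∫ ω, Z k ω ∂μ ≤ ∫ ω, Z 0 ω ∂μ := fun k => by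
    simpa using hZsup.setIntegral_le (Nat.zero_le k) MeasurableSet.univ
  have hbdd : ∀ k, eLpNorm (-Z k) 1 μ ≤ ((∫ ω, Z 0 ω ∂μ).toNNReal : NNReal) := fun k => by
    rw [eLpNorm_neg, eLpNorm_one_eq_lintegral_enorm, ← ofReal_integral_norm_eq_lintegral_enorm
      (hZi k)]
    refine ENNReal.ofReal_le_ofReal ?_
    refine le_trans (le_of_eq ?_) (hint k)
    exact integral_congr_ae (ae_of_all _ fun ω => Real.norm_of_nonneg (hZ0 k ω))
  filter_upwards [hZsup.neg.exists_ae_tendsto_of_bdd hbdd] with ω ⟨c, hc⟩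
  have hc' : Tendsto (fun k => Z k ω) atTop (𝓝 (-c)) := by simpa using hc.neg
  obtain ⟨B, hB⟩ := hc'.bddAbove_range
  have hsum : Summable fun k => D k ω := by
    refine summable_of_sum_range_le (c := B) (fun k => hD0 k ω) fun k => ?_
    have : Z k ω ≤ B := hB ⟨k, rfl⟩
    simp only [hZ] at this
    linarith [hY0 k ω]
  refine ⟨⟨-c - ∑' k, D k ω, ?_⟩, hsum⟩
  have := hc'.sub hsum.hasSum.tendsto_sum_nat
  simpa [hZ] using this

/-- If an event has constant conditional probability `q` given `𝒢`, then it splits off integrals of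
`𝒢`-measurable functions. -/
theorem setIntegral_eq_mul_integral_of_condProb_eq {Ω : Type*} {𝒢 mΩ : MeasurableSpace Ω}
    {P : Measure Ω} [IsProbabilityMeasure P] (h𝒢 : 𝒢 ≤ mΩ) {A : Set Ω} (hA : MeasurableSet A) {q : ℝ}
    (hq : P⟦A | 𝒢⟧ =ᵐ[P] fun _ => q) {g : Ω → ℝ} (hg : Measurable[𝒢] g) (hgi : Integrable g P) :
    ∫ ω in A, g ω ∂P = q * ∫ ω, g ω ∂P := by
  have hfg : g * A.indicator (fun _ => (1 : ℝ)) = A.indicator g := by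
    ext ω; by_cases h : ω ∈ A <;> simp [h]
  have hpull := condExp_mul_of_stronglyMeasurable_left (μ := P) (m := 𝒢)
    (g := A.indicator fun _ => (1 : ℝ)) hg.stronglyMeasurable
    (hfg ▸ hgi.indicator hA) ((integrable_const _).indicator hA)
  rw [hfg] at hpull
  calc ∫ ω in A, g ω ∂P = ∫ ω, A.indicator g ω ∂P := (integral_indicator hA).symm
    _ = ∫ ω, (P[A.indicator g | 𝒢]) ω ∂P := (integral_condExp h𝒢).symm
    _ = ∫ ω, q * g ω ∂P := integral_congr_ae <| by
        filter_upwards [hpull, hq] with ω h1 h2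
        rw [h1, Pi.mul_apply, h2, mul_comm]
    _ = q * ∫ ω, g ω ∂P := integral_const_mul _ _

end Stochastic

/-! ### Bookkeeping for the delay term. -/

section DelayEnergy

variable {H : Type*} [NormedAddCommGroup H]

/-- The delay part of the Lyapunov function: the squared steps, weighted linearly by how long they
stay in the window of the last `τ` steps. -/
noncomputable def delayEnergy (τ : ℕ) (x : ℕ → H) (k : ℕ) : ℝ :=
  -- The weight falls from `τ` at `d = k - 1` to `1` at `d = k - τ`; truncated subtraction makes it
  -- `0` for older steps.
  ∑ d ∈ Finset.range k, ((d + τ + 1 - k : ℕ) : ℝ) * ‖x d - x (d + 1)‖ ^ 2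

theorem delayEnergy_nonneg (τ : ℕ) (x : ℕ → H) (k : ℕ) : 0 ≤ delayEnergy τ x k :=
  Finset.sum_nonneg fun _ _ => by positivity

/-- Steps in the window have weight at least `1`. This keeps the bound `G` in `IsRun.ae_lyapunov`
nonnegative. -/
theorem sum_window_le_delayEnergy (τ : ℕ) (x : ℕ → H) (k : ℕ) :
    ∑ d ∈ Finset.Ico (k - τ) k, ‖x d - x (d + 1)‖ ^ 2 ≤ delayEnergy τ x k := by
  calc ∑ d ∈ Finset.Ico (k - τ) k, ‖x d - x (d + 1)‖ ^ 2
      ≤ ∑ d ∈ Finset.Ico (k - τ) k, ((d + τ + 1 - k : ℕ) : ℝ) * ‖x d - x (d + 1)‖ ^ 2 := by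
        refine Finset.sum_le_sum fun d hd => le_mul_of_one_le_left (by positivity) ?_
        have := Finset.mem_Ico.1 hd
        exact_mod_cast (by omega : 1 ≤ d + τ + 1 - k)
    _ ≤ _ := Finset.sum_le_sum_of_subset_of_nonneg
        (fun d hd => Finset.mem_range.2 (Finset.mem_Ico.1 hd).2) fun _ _ _ => by positivity

/-- Advancing `k` lowers each positive weight by one, which releases one copy of every squared step
in the window; the new step enters with weight `τ`. -/
theorem delayEnergy_succ_add_le (τ : ℕ) (x : ℕ → H) (k : ℕ) {J : Finset ℕ}
    (hJ : J ⊆ Finset.Ico (k - τ) k) :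
    delayEnergy τ x (k + 1) + ∑ d ∈ J, ‖x d - x (d + 1)‖ ^ 2 ≤
      delayEnergy τ x k + τ * ‖x k - x (k + 1)‖ ^ 2 := by
  have hJ' : ∑ d ∈ J, ‖x d - x (d + 1)‖ ^ 2 ≤
      ∑ d ∈ Finset.range k, if k ≤ d + τ then ‖x d - x (d + 1)‖ ^ 2 else 0 := by
    rw [← Finset.sum_filter]
    refine Finset.sum_le_sum_of_subset_of_nonneg (fun d hd => ?_) fun _ _ _ => by positivity
    have := Finset.mem_Ico.1 (hJ hd)
    simp only [Finset.mem_filter, Finset.mem_range]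
    omega
  have hid : delayEnergy τ x k = ∑ d ∈ Finset.range k, (((d + τ + 1 - (k + 1) : ℕ) : ℝ) *
      ‖x d - x (d + 1)‖ ^ 2 + if k ≤ d + τ then ‖x d - x (d + 1)‖ ^ 2 else 0) := by
    refine Finset.sum_congr rfl fun d _ => ?_
    split_ifs with h
    · rw [show d + τ + 1 - k = (d + τ + 1 - (k + 1)) + 1 by omega]
      push_cast; ring
    · rw [show d + τ + 1 - k = 0 by omega, show d + τ + 1 - (k + 1) = 0 by omega]
      simp
  rw [hid, Finset.sum_add_distrib, delayEnergy, Finset.sum_range_succ,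
    show k + τ + 1 - (k + 1) = τ by omega]
  linarith

end DelayEnergy

/-! ### Cocoercivity of the residual. -/

section Descent

variable {H : Type*} [NormedAddCommGroup H] [InnerProductSpace ℝ H]

/-- For nonexpansive `T`, the residual `I - T` is `1/2`-cocoercive at fixed points. -/
theorem half_sq_norm_residual_le_inner {T : H → H} (hT : LipschitzWith 1 T) {a : H} (ha : T a = a)
    (h : H) : 1 / 2 * ‖h - T h‖ ^ 2 ≤ inner ℝ (h - a) (h - T h) := by
  have h1 : ‖T h - a‖ ≤ ‖h - a‖ := by simpa [ha] using hT.norm_sub_le h a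
  have h2 : ‖T h - a‖ ^ 2 = ‖h - a‖ ^ 2 - 2 * inner ℝ (h - a) (h - T h) + ‖h - T h‖ ^ 2 := by
    rw [← norm_sub_sq_real]; congr 2; abel
  have h3 : ‖T h - a‖ ^ 2 ≤ ‖h - a‖ ^ 2 := by gcongr
  linarith

end Descent

/-! ### Averaging over the selected coordinate, and the Lyapunov decrease. -/

section Coordinates

theorem continuous_coordS {m : ℕ} {E : Fin m → Type*} [∀ i, NormedAddCommGroup (E i)]
    {T : Space E → Space E} (hT : Continuous T) (i : Fin m) :
    Continuous (coordS T i) := by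
  unfold coordS
  have h1 : Continuous fun h : Space E => (h - T h) i :=
    (PiLp.continuous_apply 2 _ i).comp (continuous_id.sub hT)
  exact (PiLp.continuous_toLp 2 _).comp ((continuous_single i).comp h1)

variable {m : ℕ} {E : Fin m → Type*} [∀ i, NormedAddCommGroup (E i)]
  [∀ i, InnerProductSpace ℝ (E i)]

theorem inner_coordS (T : Space E → Space E) (i : Fin m) (u h : Space E) :
    inner ℝ u (coordS T i h) = inner ℝ (u i) ((h - T h) i) := by
  rw [PiLp.inner_apply, Finset.sum_eq_single i]
  · simp [coordS]
  · intro j _ hj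
    simp [coordS, hj]
  · simp

theorem norm_coordS (T : Space E → Space E) (i : Fin m) (h : Space E) :
    ‖coordS T i h‖ = ‖(h - T h) i‖ := by
  have h1 : ‖coordS T i h‖ ^ 2 = ‖(h - T h) i‖ ^ 2 := by
    rw [← real_inner_self_eq_norm_sq, inner_coordS, ← real_inner_self_eq_norm_sq]
    simp [coordS]
  exact (sq_eq_sq₀ (norm_nonneg _) (norm_nonneg _)).1 h1

theorem norm_coordS_le (T : Space E → Space E) (i : Fin m) (h : Space E) :
    ‖coordS T i h‖ ≤ ‖h - T h‖ := by
  rw [norm_coordS]; exact PiLp.norm_apply_le _ i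

theorem pmin_le (p : Fin m → ℝ) (i : Fin m) : pmin p ≤ p i :=
  ciInf_le (Set.finite_range p).bddBelow i

theorem pmin_pos [Nonempty (Fin m)] {p : Fin m → ℝ} (hp : ∀ i, 0 < p i) : 0 < pmin p := by
  obtain ⟨i, hi⟩ := exists_eq_ciInf_of_finite (f := p)
  exact (hp i).trans_eq hi

/-- Mean over the selected coordinate of the squared distance after one coordinate step. -/
theorem sum_mul_sq_norm_coord_step (T : Space E → Space E) {p : Fin m → ℝ} (hp : ∀ i, 0 < p i)
    (hp_sum : ∑ i, p i = 1) (B : ℝ) (u h : Space E) :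
    ∑ i, p i * ‖u - (B / p i) • coordS T i h‖ ^ 2 =
      ‖u‖ ^ 2 - 2 * B * inner ℝ u (h - T h) + ∑ i, p i * ‖(B / p i) • coordS T i h‖ ^ 2 := by
  -- The probability cancels the `1 / p i` in the step, so the cross terms reassemble the full inner
  -- product.
  have h1 : ∀ i, p i * ‖u - (B / p i) • coordS T i h‖ ^ 2 =
      p i * ‖u‖ ^ 2 - 2 * B * inner ℝ (u i) ((h - T h) i) +
        p i * ‖(B / p i) • coordS T i h‖ ^ 2 := by
    intro i
    have := (hp i).ne'
    rw [norm_sub_sq_real, inner_smul_right, inner_coordS]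
    field_simp
  simp_rw [h1, Finset.sum_add_distrib, Finset.sum_sub_distrib, ← Finset.sum_mul, ← Finset.mul_sum,
    hp_sum, one_mul, ← PiLp.inner_apply]

/-- The coordinates are orthogonal, and each contributes with factor `p i * (B / p i)² = B² / p i`.
-/
theorem sum_mul_sq_norm_smul_coordS_le (T : Space E → Space E) {p : Fin m → ℝ} (hp : ∀ i, 0 < p i)
    {q : ℝ} (hq : 0 < q) (hqp : ∀ i, q ≤ p i) (B : ℝ) (h : Space E) :
    ∑ i, p i * ‖(B / p i) • coordS T i h‖ ^ 2 ≤ B ^ 2 / q * ‖h - T h‖ ^ 2 := by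
  rw [PiLp.norm_sq_eq_of_L2, Finset.mul_sum]
  refine Finset.sum_le_sum fun i _ => ?_
  have := (hp i).ne'
  rw [norm_smul, norm_coordS, mul_pow, Real.norm_eq_abs, sq_abs,
    show p i * ((B / p i) ^ 2 * ‖(h - T h) i‖ ^ 2) = B ^ 2 / p i * ‖(h - T h) i‖ ^ 2 by field_simp]
  gcongr
  exact hqp i

/-- The one-step mean decrease of the Lyapunov function. Here `r ^ 2` is a lower bound for the
selection probabilities and `B = η / m`. -/
theorem lyapunov_mean_decrease {T : Space E → Space E} (hT : LipschitzWith 1 T) {a : Space E}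
    (ha : T a = a) {p : Fin m → ℝ} (hp : ∀ i, 0 < p i) (hp_sum : ∑ i, p i = 1) {r : ℝ}
    (hr : 0 < r) (hrp : ∀ i, r ^ 2 ≤ p i) {τ : ℕ} {B c : ℝ} (hB : 0 < B)
    (hBc : B * (2 * τ * r + 1) ≤ c * r ^ 2) {x : ℕ → Space E} {k : ℕ} {h : Space E}
    {J : Finset ℕ} (hJ : J ⊆ Finset.Ico (k - τ) k) (hh : h = x k + ∑ d ∈ J, (x d - x (d + 1)))
    (V : ℝ) :
    ∑ i, p i * (‖x k - (B / p i) • coordS T i h - a‖ ^ 2 +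
        r * (V - ∑ d ∈ Finset.Ico (k - τ) k, ‖x d - x (d + 1)‖ ^ 2 +
          τ * ‖(B / p i) • coordS T i h‖ ^ 2)) + (1 - c) * B * ‖h - T h‖ ^ 2 ≤
      ‖x k - a‖ ^ 2 + r * V := by
  set s := h - T h with hs
  set W := ∑ d ∈ Finset.Ico (k - τ) k, ‖x d - x (d + 1)‖ ^ 2 with hW
  set R := ∑ i, p i * ‖(B / p i) • coordS T i h‖ ^ 2 with hR
  have hsum : ∑ i, p i * (‖x k - (B / p i) • coordS T i h - a‖ ^ 2 +
      r * (V - W + τ * ‖(B / p i) • coordS T i h‖ ^ 2)) =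
      ‖x k - a‖ ^ 2 - 2 * B * inner ℝ (x k - a) s + R + r * (V - W) + r * τ * R := by
    rw [← sum_mul_sq_norm_coord_step T hp hp_sum B (x k - a) h]
    have : ∀ i, p i * (‖x k - (B / p i) • coordS T i h - a‖ ^ 2 +
        r * (V - W + τ * ‖(B / p i) • coordS T i h‖ ^ 2)) =
        p i * ‖x k - a - (B / p i) • coordS T i h‖ ^ 2 + p i * (r * (V - W)) +
          r * τ * (p i * ‖(B / p i) • coordS T i h‖ ^ 2) := by
      intro i
      rw [sub_right_comm]; ring
    simp_rw [this, Finset.sum_add_distrib, ← Finset.sum_mul, ← Finset.mul_sum, hp_sum, one_mul]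
    rw [← hR]
  have hRle : R ≤ B ^ 2 / r ^ 2 * ‖s‖ ^ 2 :=
    sum_mul_sq_norm_smul_coordS_le T hp (by positivity) hrp B h
  have hcoc := half_sq_norm_residual_le_inner hT ha h
  have hinner : inner ℝ (x k - a) s = inner ℝ (h - a) s - ∑ d ∈ J, inner ℝ (x d - x (d + 1)) s := by
    rw [← sum_inner, ← inner_sub_left, hh]; congr 1; abel
  -- Young's inequality with weight `r` on each delayed step: the step part is paid by the released
  -- energy `r * W`, and there are at most `τ` terms.
  have hyoung : ∑ d ∈ J, 2 * B * inner ℝ (x d - x (d + 1)) s ≤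
      r * W + τ * (B ^ 2 / r * ‖s‖ ^ 2) := by
    have hcard : (J.card : ℝ) ≤ τ := by
      have := Finset.card_le_card hJ
      rw [Nat.card_Ico] at this
      exact_mod_cast this.trans (by omega)
    calc ∑ d ∈ J, 2 * B * inner ℝ (x d - x (d + 1)) s
        ≤ ∑ d ∈ J, (r * ‖x d - x (d + 1)‖ ^ 2 + B ^ 2 / r * ‖s‖ ^ 2) := by
          refine Finset.sum_le_sum fun d _ => ?_
          have h1 := real_inner_le_norm (x d - x (d + 1)) s
          have h2 : 2 * B * (‖x d - x (d + 1)‖ * ‖s‖) ≤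
              r * ‖x d - x (d + 1)‖ ^ 2 + B ^ 2 / r * ‖s‖ ^ 2 := by
            have : r * ‖x d - x (d + 1)‖ ^ 2 + B ^ 2 / r * ‖s‖ ^ 2 -
                2 * B * (‖x d - x (d + 1)‖ * ‖s‖) = (r * ‖x d - x (d + 1)‖ - B * ‖s‖) ^ 2 / r := by
              field_simp; ring
            have : 0 ≤ (r * ‖x d - x (d + 1)‖ - B * ‖s‖) ^ 2 / r := by positivity
            linarith
          exact (mul_le_mul_of_nonneg_left h1 (by positivity)).trans h2
      _ = r * ∑ d ∈ J, ‖x d - x (d + 1)‖ ^ 2 + J.card * (B ^ 2 / r * ‖s‖ ^ 2) := by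
          rw [Finset.sum_add_distrib, ← Finset.mul_sum, Finset.sum_const, nsmul_eq_mul]
      _ ≤ _ := by
          gcongr
          exact Finset.sum_le_sum_of_subset_of_nonneg hJ fun _ _ _ => by positivity
  rw [← Finset.mul_sum] at hyoung
  -- The costs in units of `‖s‖²`: the squared step (`1`), its entry into the delay energy (`r *
  -- τ`), and Young's remainder. Cocoercivity supplies `B`, leaving `(1 - c) * B`.
  have hcoef : (1 + r * τ) * (B ^ 2 / r ^ 2) + τ * (B ^ 2 / r) ≤ c * B := by
    rw [show (1 + r * τ) * (B ^ 2 / r ^ 2) + τ * (B ^ 2 / r) = B * (B * (2 * τ * r + 1)) / r ^ 2 by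
      field_simp; ring, div_le_iff₀ (by positivity)]
    nlinarith [mul_le_mul_of_nonneg_left hBc hB.le]
  have hN : 0 ≤ ‖s‖ ^ 2 := by positivity
  have h1 := mul_le_mul_of_nonneg_right hcoef hN
  have h2 := mul_le_mul_of_nonneg_left hRle (show 0 ≤ 1 + r * τ by positivity)
  have h3 := mul_le_mul_of_nonneg_left hcoc hB.le
  rw [hsum, hinner]
  nlinarith

end Coordinates

/-! ### From delayed residuals to residuals at the iterates. -/

section Residual

theorem tendsto_sum_window {u : ℕ → ℝ} (hu : Tendsto u atTop (𝓝 0)) (τ : ℕ) :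
    Tendsto (fun k => ∑ d ∈ Finset.Ico (k - τ) k, u d) atTop (𝓝 0) := by
  have h : Tendsto (fun k => ∑ i ∈ Finset.range τ, u (k - τ + i)) atTop (𝓝 0) := by
    rw [← Finset.sum_const_zero (s := Finset.range τ)]
    exact tendsto_finsetSum _ fun i _ =>
      hu.comp ((tendsto_add_atTop_nat i).comp (tendsto_sub_atTop_nat τ))
  refine h.congr' ?_
  filter_upwards [eventually_ge_atTop τ] with k hk
  rw [Finset.sum_Ico_eq_sum_range, Nat.sub_sub_self hk]

variable {H : Type*} [NormedAddCommGroup H]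

theorem tendsto_delayEnergy {x : ℕ → H} (hx : Tendsto (fun k => ‖x k - x (k + 1)‖) atTop (𝓝 0))
    (τ : ℕ) : Tendsto (fun k => delayEnergy τ x k) atTop (𝓝 0) := by
  have hx2 : Tendsto (fun k => (τ : ℝ) * ‖x k - x (k + 1)‖ ^ 2) atTop (𝓝 0) := by
    simpa using (hx.pow 2).const_mul (τ : ℝ)
  refine squeeze_zero (fun k => delayEnergy_nonneg τ x k) (fun k => ?_) (tendsto_sum_window hx2 τ)
  rw [delayEnergy, ← Finset.sum_subset (s₁ := Finset.Ico (k - τ) k)]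
  · refine Finset.sum_le_sum fun d hd => ?_
    have := Finset.mem_Ico.1 hd
    gcongr
    omega
  · intro d hd
    exact Finset.mem_range.2 (Finset.mem_Ico.1 hd).2
  · intro d hd hd'
    rw [Finset.mem_range] at hd
    rw [Finset.mem_Ico] at hd'
    rw [show d + τ + 1 - k = 0 by omega]
    simp

/-- If steps and residuals at the delayed reads vanish, so do the residuals at the iterates. -/
theorem tendsto_residual_of_delayed {T : H → H} (hT : LipschitzWith 1 T) {x h : ℕ → H} {τ : ℕ}
    (hx : Tendsto (fun k => ‖x k - x (k + 1)‖) atTop (𝓝 0))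
    (hh : Tendsto (fun k => ‖h k - T (h k)‖) atTop (𝓝 0))
    (hread : ∀ k, ∃ J : Finset ℕ, J ⊆ Finset.Ico (k - τ) k ∧
      h k = x k + ∑ d ∈ J, (x d - x (d + 1))) :
    Tendsto (fun k => x k - T (x k)) atTop (𝓝 0) := by
  -- The factor `2` is a Lipschitz constant of `I - T`.
  have hlim := hh.add ((tendsto_sum_window hx τ).const_mul 2)
  rw [mul_zero, add_zero] at hlim
  refine squeeze_zero_norm (fun k => ?_) hlim
  obtain ⟨J, hJ, hk⟩ := hread k
  have h1 : ‖h k - x k‖ ≤ ∑ d ∈ Finset.Ico (k - τ) k, ‖x d - x (d + 1)‖ := by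
    rw [hk, add_sub_cancel_left]
    exact (norm_sum_le _ _).trans
      (Finset.sum_le_sum_of_subset_of_nonneg hJ fun _ _ _ => norm_nonneg _)
  have h2 : ‖T (h k) - T (x k)‖ ≤ ‖h k - x k‖ := by simpa using hT.norm_sub_le (h k) (x k)
  calc ‖x k - T (x k)‖ = ‖(h k - T (h k)) + (T (h k) - T (x k)) - (h k - x k)‖ := by
        congr 1; abel
    _ ≤ ‖h k - T (h k)‖ + ‖T (h k) - T (x k)‖ + ‖h k - x k‖ :=
        (norm_sub_le _ _).trans (by gcongr; exact norm_add_le _ _)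
    _ ≤ _ := by linarith

end Residual

/-! ### The Lyapunov function along a run. -/

section Run

variable {m : ℕ} {E : Fin m → Type*} [∀ i, NormedAddCommGroup (E i)]
  [∀ i, InnerProductSpace ℝ (E i)] [∀ i, MeasurableSpace (E i)]
  {Ω : Type*} [MeasurableSpace Ω] {P : Measure Ω}
  {T : Space E → Space E} {p : Fin m → ℝ} {η : ℕ → ℝ} {τ : ℕ}
  {idx : ℕ → Ω → Fin m} {x xhat : ℕ → Ω → Space E}

/-- The filtration of the algorithm. -/
def IsRun.filtration (hrun : IsRun T p η τ P idx x xhat) : Filtration ℕ ‹MeasurableSpace Ω› where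
  seq := history x xhat
  mono' _ _ hkl := biSup_mono fun _ hj =>
    Finset.mem_range.2 ((Finset.mem_range.1 hj).trans_le (by omega))
  le' _ := iSup₂_le fun j _ => sup_le (hrun.measurable_iterate j).comap_le
    (hrun.measurable_read j).comap_le

theorem IsRun.measurable_iterate_history (hrun : IsRun T p η τ P idx x xhat) {j k : ℕ}
    (hjk : j ≤ k) : Measurable[hrun.filtration k] (x j) :=
  measurable_iff_comap_le.2 <| le_sup_left.trans <| le_iSup₂_of_le
    (f := fun j (_ : j ∈ Finset.range (k + 1)) =>
      MeasurableSpace.comap (x j) inferInstance ⊔ MeasurableSpace.comap (xhat j) inferInstance)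
    j (Finset.mem_range.2 (by omega)) le_rfl

theorem IsRun.measurable_read_history (hrun : IsRun T p η τ P idx x xhat) (k : ℕ) :
    Measurable[hrun.filtration k] (xhat k) :=
  measurable_iff_comap_le.2 <| le_sup_right.trans <| le_iSup₂_of_le
    (f := fun j (_ : j ∈ Finset.range (k + 1)) =>
      MeasurableSpace.comap (x j) inferInstance ⊔ MeasurableSpace.comap (xhat j) inferInstance)
    k (Finset.mem_range.2 (by omega)) le_rfl

theorem IsRun.update' (hrun : IsRun T p η τ P idx x xhat) (k : ℕ) (ω : Ω) :
    x (k + 1) ω = x k ω - (η k / m / p (idx k ω)) • coordS T (idx k ω) (xhat k ω) := by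
  rw [hrun.update, div_div]

/-- The steps are dominated by the residuals at the delayed reads. -/
theorem IsRun.norm_step_le (hrun : IsRun T p η τ P idx x xhat) (hp : ∀ i, 0 < p i) {k : ℕ}
    (hη : 0 ≤ η k) (hηp : ∀ i, η k / m ≤ p i) (ω : Ω) :
    ‖x k ω - x (k + 1) ω‖ ≤ ‖xhat k ω - T (xhat k ω)‖ := by
  have hq : 0 ≤ η k / m / p (idx k ω) := by have := hp (idx k ω); positivity
  rw [hrun.update', sub_sub_cancel, norm_smul, Real.norm_of_nonneg hq]
  exact (mul_le_of_le_one_left (norm_nonneg _) ((div_le_one (hp _)).2 (hηp _))).trans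
    (norm_coordS_le T _ _)

variable [∀ i, TopologicalSpace.SeparableSpace (E i)] [∀ i, BorelSpace (E i)]
  [IsProbabilityMeasure P]

/-- Almost sure convergence of the Lyapunov function and square summability of the residuals at the
delayed reads. -/
theorem IsRun.ae_lyapunov (hrun : IsRun T p η τ P idx x xhat) (hT : LipschitzWith 1 T)
    {a : Space E} (ha : T a = a) (hp : ∀ i, 0 < p i) (hp_sum : ∑ i, p i = 1) {r c B₀ : ℝ}
    (hr : 0 < r) (hrp : ∀ i, r ^ 2 ≤ p i) (hc : c < 1) (hB₀ : 0 < B₀) (hηB : ∀ k, B₀ ≤ η k / m)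
    (hBc : ∀ k, η k / m * (2 * τ * r + 1) ≤ c * r ^ 2) :
    ∀ᵐ ω ∂P, (∃ l, Tendsto
      (fun k => ‖x k ω - a‖ ^ 2 + r * delayEnergy τ (fun n => x n ω) k) atTop (𝓝 l)) ∧
      Summable fun k => ‖xhat k ω - T (xhat k ω)‖ ^ 2 := by
  have : ∀ i, SecondCountableTopology (E i) := fun i => UniformSpace.secondCountable_of_separable _
  set ℱ := hrun.filtration with hℱ
  set Y : ℕ → Ω → ℝ := fun k ω => ‖x k ω - a‖ ^ 2 + r * delayEnergy τ (fun n => x n ω) k with hY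
  set D : ℕ → Ω → ℝ := fun k ω => (1 - c) * B₀ * ‖xhat k ω - T (xhat k ω)‖ ^ 2 with hD
  -- `G k i` bounds `Y (k + 1)` when coordinate `i` is selected, and uses only the history up to
  -- `k`.
  set G : ℕ → Fin m → Ω → ℝ := fun k i ω =>
    ‖x k ω - (η k / m / p i) • coordS T i (xhat k ω) - a‖ ^ 2 +
      r * (delayEnergy τ (fun n => x n ω) k -
        ∑ d ∈ Finset.Ico (k - τ) k, ‖x d ω - x (d + 1) ω‖ ^ 2 +
        τ * ‖(η k / m / p i) • coordS T i (xhat k ω)‖ ^ 2) with hG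
  have hx : ∀ {j k}, j ≤ k → Measurable[ℱ k] (x j) := hrun.measurable_iterate_history
  have hxa : ∀ {j k}, j ≤ k → Measurable[ℱ k] fun ω => ‖x j ω - a‖ := fun hjk =>
    (continuous_id.sub (continuous_const (y := a))).norm.measurable.comp (hx hjk)
  have hstep : ∀ {d k}, d < k → Measurable[ℱ k] fun ω => ‖x d ω - x (d + 1) ω‖ ^ 2 := fun hd =>
    (measurable_norm.comp ((hx hd.le).sub (hx hd))).pow_const 2
  have hV : ∀ k, Measurable[ℱ k] fun ω => delayEnergy τ (fun n => x n ω) k := fun k =>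
    Finset.measurable_fun_sum _ fun d hd => (hstep (Finset.mem_range.1 hd)).const_mul _
  have hYm : ∀ k, Measurable[ℱ k] (Y k) := fun k =>
    ((hxa le_rfl).pow_const 2).add ((hV k).const_mul r)
  have hDm : ∀ k, Measurable[ℱ k] (D k) := fun k =>
    ((continuous_id.sub hT.continuous).norm.measurable.comp
      (hrun.measurable_read_history k)).pow_const 2 |>.const_mul _
  have hGm : ∀ k i, Measurable[ℱ k] (G k i) := fun k i => by
    have hS : Measurable[ℱ k] fun ω => (η k / m / p i) • coordS T i (xhat k ω) :=
      ((continuous_coordS hT.continuous i).const_smul (η k / m / p i)).measurable.comp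
        (hrun.measurable_read_history k)
    have hSa : Measurable[ℱ k] fun ω =>
        ‖x k ω - (η k / m / p i) • coordS T i (xhat k ω) - a‖ :=
      (continuous_id.sub (continuous_const (y := a))).norm.measurable.comp ((hx le_rfl).sub hS)
    exact (hSa.pow_const 2).add ((((hV k).sub (Finset.measurable_fun_sum _ fun d hd =>
      hstep (Finset.mem_Ico.1 hd).2)).add (((measurable_norm.comp hS).pow_const 2).const_mul _)).const_mul r)
  have hY0 : ∀ k ω, 0 ≤ Y k ω := fun k ω => by
    have := delayEnergy_nonneg τ (fun n => x n ω) k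
    positivity
  have hD0 : ∀ k ω, 0 ≤ D k ω := fun k ω => by
    have := sub_pos.2 hc
    positivity
  have hYG : ∀ k ω, Y (k + 1) ω ≤ G k (idx k ω) ω := fun k ω => by
    have h1 := delayEnergy_succ_add_le τ (fun n => x n ω) k (Finset.Subset.refl _)
    have h2 : x k ω - x (k + 1) ω = (η k / m / p (idx k ω)) • coordS T (idx k ω) (xhat k ω) := by
      rw [hrun.update', sub_sub_cancel]
    simp only [hY, hG]
    rw [← hrun.update', ← h2]
    gcongr
    linarith
  have hG0 : ∀ k i ω, 0 ≤ G k i ω := fun k i ω => by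
    have h1 := sub_nonneg.2 (sum_window_le_delayEnergy τ (fun n => x n ω) k)
    positivity
  have hGY : ∀ k ω, ∑ i, p i * G k i ω + D k ω ≤ Y k ω := fun k ω => by
    obtain ⟨J, hJ, hh⟩ := hrun.read k ω
    have h1 := lyapunov_mean_decrease hT ha hp hp_sum hr hrp (hB₀.trans_le (hηB k)) (hBc k)
      (x := fun n => x n ω) hJ hh (delayEnergy τ (fun n => x n ω) k)
    refine le_trans ?_ h1
    simp only [hG, hD]
    have := sub_pos.2 hc
    gcongr
    exact hηB k
  have hDY : ∀ k ω, D k ω ≤ Y k ω := fun k ω => by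
    have := Finset.sum_nonneg fun i (_ : i ∈ Finset.univ) => mul_nonneg (hp i).le (hG0 k i ω)
    linarith [hGY k ω]
  have hGYi : ∀ k i ω, G k i ω ≤ (p i)⁻¹ * Y k ω := fun k i ω => by
    rw [le_inv_mul_iff₀ (hp i)]
    have := Finset.single_le_sum (f := fun i => p i * G k i ω)
      (fun i _ => mul_nonneg (hp i).le (hG0 k i ω)) (Finset.mem_univ i)
    linarith [hGY k ω, hD0 k ω]
  -- The initial iterate need not be square integrable, so the argument is localized to events on
  -- which it is bounded; these lie in every `ℱ k` and exhaust `Ω`.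
  have main : ∀ N : ℕ, ∀ᵐ ω ∂P.restrict {ω | ‖x 0 ω - a‖ ≤ N},
      (∃ l, Tendsto (fun k => Y k ω) atTop (𝓝 l)) ∧ Summable fun k => D k ω := by
    intro N
    set A : Set Ω := {ω | ‖x 0 ω - a‖ ≤ N} with hA
    have hAm : ∀ k, MeasurableSet[ℱ k] A := fun k =>
      measurableSet_le (hxa (Nat.zero_le k)) measurable_const
    have hGi : ∀ k, Integrable (Y k) (P.restrict A) → ∀ i, Integrable (G k i) (P.restrict A) :=
      fun k hYk i => (hYk.const_mul (p i)⁻¹).mono'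
        ((hGm k i).mono (ℱ.le k) le_rfl).aestronglyMeasurable
        (ae_of_all _ fun ω => (Real.norm_of_nonneg (hG0 k i ω)).trans_le (hGYi k i ω))
    have hYi : ∀ k, Integrable (Y k) (P.restrict A) := by
      intro k
      induction k with
      | zero =>
        refine (integrable_const ((N : ℝ) ^ 2)).mono'
          ((hYm 0).mono (ℱ.le 0) le_rfl).aestronglyMeasurable ?_
        filter_upwards [ae_restrict_mem (ℱ.le 0 _ (hAm 0))] with ω hω
        rw [Real.norm_of_nonneg (hY0 0 ω)]
        have : ‖x 0 ω - a‖ ≤ N := hω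
        simp only [hY, delayEnergy, Finset.range_zero, Finset.sum_empty, mul_zero, add_zero]
        gcongr
      | succ k ih =>
        refine (integrable_finsetSum Finset.univ fun i _ => hGi k ih i).mono'
          ((hYm _).mono (ℱ.le _) le_rfl).aestronglyMeasurable (ae_of_all _ fun ω => ?_)
        rw [Real.norm_of_nonneg (hY0 _ ω)]
        exact (hYG k ω).trans (Finset.single_le_sum (f := fun i => G k i ω)
          (fun i _ => hG0 k i ω) (Finset.mem_univ (idx k ω)))
    have hDi : ∀ k, Integrable (D k) (P.restrict A) := fun k => (hYi k).mono'
      ((hDm k).mono (ℱ.le k) le_rfl).aestronglyMeasurable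
      (ae_of_all _ fun ω => (Real.norm_of_nonneg (hD0 k ω)).trans_le (hDY k ω))
    refine ae_tendsto_and_summable_of_setIntegral_add_le hYm hDm hYi hDi hY0 hD0 fun k s hs => ?_
    have hsA : MeasurableSet[ℱ k] (s ∩ A) := hs.inter (hAm k)
    have hsA' := ℱ.le k _ hsA
    have hrestr : (P.restrict A).restrict s = P.restrict (s ∩ A) :=
      Measure.restrict_restrict (ℱ.le k _ hs)
    have hGi' : ∀ i, Integrable (G k i) (P.restrict (s ∩ A)) := fun i =>
      hrestr ▸ (hGi k (hYi k) i).restrict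
    have hYi' : ∀ j, Integrable (Y j) (P.restrict (s ∩ A)) := fun j => hrestr ▸ (hYi j).restrict
    have hDi' : Integrable (D k) (P.restrict (s ∩ A)) := hrestr ▸ (hDi k).restrict
    have hidx : ∀ i, MeasurableSet (idx k ⁻¹' {i}) := fun i =>
      hrun.measurable_idx k (measurableSet_singleton i)
    -- The selection law refers to `P`, not to the restricted measure, so `s ∩ A` is absorbed into
    -- an `ℱ k`-measurable integrand.
    have hsplit : ∀ i, ∫ ω in s ∩ A, (idx k ⁻¹' {i}).indicator (G k i) ω ∂P =
        p i * ∫ ω in s ∩ A, G k i ω ∂P := by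
      intro i
      rw [setIntegral_indicator (hidx i), Set.inter_comm, ← setIntegral_indicator hsA',
        ← integral_indicator hsA']
      exact setIntegral_eq_mul_integral_of_condProb_eq (ℱ.le k) (hidx i) (hrun.select k i)
        ((hGm k i).indicator hsA) ((integrable_indicator_iff hsA').2 (hGi' i))
    rw [hrestr]
    calc ∫ ω in s ∩ A, Y (k + 1) ω ∂P + ∫ ω in s ∩ A, D k ω ∂P
        ≤ ∫ ω in s ∩ A, ∑ i, (idx k ⁻¹' {i}).indicator (G k i) ω ∂P + ∫ ω in s ∩ A, D k ω ∂P := by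
          refine add_le_add_left ?_ _
          refine integral_mono (hYi' _)
            (integrable_finsetSum _ fun i _ => (hGi' i).indicator (hidx i)) fun ω => ?_
          refine (hYG k ω).trans (le_of_eq ?_)
          rw [Finset.sum_eq_single (idx k ω)]
          · simp
          · intro i _ hi
            exact Set.indicator_of_notMem (fun h => hi h.symm) _
          · simp
      _ = ∫ ω in s ∩ A, (∑ i, p i * G k i ω + D k ω) ∂P := by
          rw [integral_finsetSum _ fun i _ => (hGi' i).indicator (hidx i),
            integral_add (integrable_finsetSum _ fun i _ => (hGi' i).const_mul _) hDi',
            integral_finsetSum _ fun i _ => (hGi' i).const_mul _]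
          simp_rw [hsplit, integral_const_mul]
      _ ≤ ∫ ω in s ∩ A, Y k ω ∂P :=
          integral_mono ((integrable_finsetSum _ fun i _ => (hGi' i).const_mul _).add hDi') (hYi' k)
            fun ω => hGY k ω
  rw [← ae_restrict_iUnion_iff, show ⋃ N : ℕ, {ω | ‖x 0 ω - a‖ ≤ N} = Set.univ from
    Set.eq_univ_of_forall fun ω => Set.mem_iUnion.2 (exists_nat_ge ‖x 0 ω - a‖), Measure.restrict_univ] at main
  filter_upwards [main] with ω hω
  exact ⟨hω.1, (summable_mul_left_iff (mul_pos (sub_pos.2 hc) hB₀).ne').1 hω.2⟩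

end Run

/-! ### Almost sure convergence of the iterates. -/

section Convergence

variable {m : ℕ} {E : Fin m → Type*} [∀ i, NormedAddCommGroup (E i)]
  [∀ i, InnerProductSpace ℝ (E i)] [∀ i, MeasurableSpace (E i)]
  [∀ i, TopologicalSpace.SeparableSpace (E i)] [∀ i, BorelSpace (E i)]
  {Ω : Type*} [MeasurableSpace Ω] {P : Measure Ω}
  {T : Space E → Space E} {p : Fin m → ℝ} {η : ℕ → ℝ} {τ : ℕ}
  {idx : ℕ → Ω → Fin m} {x xhat : ℕ → Ω → Space E}

/-- Almost surely, the iterates are asymptotically regular and their distances to all fixed points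
converge. -/
theorem IsRun.ae_fejer [IsProbabilityMeasure P] (hrun : IsRun T p η τ P idx x xhat) (hT : LipschitzWith 1 T)
    (hfix : ∃ a, T a = a) (hp : ∀ i, 0 < p i) (hp_sum : ∑ i, p i = 1) {r c B₀ : ℝ}
    (hr : 0 < r) (hrp : ∀ i, r ^ 2 ≤ p i) (hc : c < 1) (hB₀ : 0 < B₀) (hηB : ∀ k, B₀ ≤ η k / m)
    (hBc : ∀ k, η k / m * (2 * τ * r + 1) ≤ c * r ^ 2) :
    ∀ᵐ ω ∂P, Tendsto (fun k => x k ω - T (x k ω)) atTop (𝓝 0) ∧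
      ∀ a, T a = a → ∃ l, Tendsto (fun k => ‖x k ω - a‖) atTop (𝓝 l) := by
  have : ∀ i, SecondCountableTopology (E i) := fun i => UniformSpace.secondCountable_of_separable _
  obtain ⟨D, hDfix, hDc, hD⟩ := (TopologicalSpace.IsSeparable.of_separableSpace
    {a | T a = a}).exists_countable_dense_subset
  obtain ⟨a₀, ha₀⟩ := hfix
  have hlyap := fun a (ha : T a = a) => hrun.ae_lyapunov hT ha hp hp_sum hr hrp hc hB₀ hηB hBc
  -- This follows from `2 * τ * r + 1 ≥ 1` and `c < 1`; it lets the residuals dominate the steps.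
  have hηp : ∀ k i, η k / m ≤ p i := fun k i => by
    have h1 : η k / m * 1 ≤ η k / m * (2 * τ * r + 1) :=
      mul_le_mul_of_nonneg_left (by nlinarith [mul_nonneg (Nat.cast_nonneg (α := ℝ) τ) hr.le])
        (hB₀.le.trans (hηB k))
    nlinarith [hBc k, hrp i, sq_nonneg r]
  have hη0 : ∀ k, 0 ≤ η k := fun k => by
    by_contra! h
    exact absurd (hB₀.trans_le (hηB k)) (not_lt.2 (div_nonpos_of_nonpos_of_nonneg h.le (by simp)))
  filter_upwards [hlyap a₀ ha₀, (ae_ball_iff hDc).2 fun a ha => hlyap a (hDfix ha)] with ω h₀ hω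
  have hs : Tendsto (fun k => ‖xhat k ω - T (xhat k ω)‖) atTop (𝓝 0) := by
    have := h₀.2.tendsto_atTop_zero.sqrt
    simpa using this
  have hstep : Tendsto (fun k => ‖x k ω - x (k + 1) ω‖) atTop (𝓝 0) :=
    squeeze_zero (fun _ => norm_nonneg _) (fun k => hrun.norm_step_le hp (hη0 k) (hηp k) ω) hs
  refine ⟨tendsto_residual_of_delayed hT (x := fun k => x k ω) (h := fun k => xhat k ω) hstep hs
    fun k => hrun.read k ω, fun a ha => ?_⟩
  refine exists_tendsto_norm_sub_of_mem_closure (D := D) (fun b hb => ?_) (hD ha)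
  obtain ⟨l, hl⟩ := (hω b hb).1
  have h1 := (hl.sub ((tendsto_delayEnergy (x := fun k => x k ω) hstep τ).const_mul r)).sqrt
  exact ⟨_, by simpa using h1⟩

/-- Almost surely, the iterates converge weakly to a random fixed point. -/
theorem IsRun.exists_ae_weak_limit [∀ i, CompleteSpace (E i)]
    (hrun : IsRun T p η τ P idx x xhat) (hT : LipschitzWith 1 T) (hfix : ∃ a, T a = a)
    (hfejer : ∀ᵐ ω ∂P, Tendsto (fun k => x k ω - T (x k ω)) atTop (𝓝 0) ∧
      ∀ a, T a = a → ∃ l, Tendsto (fun k => ‖x k ω - a‖) atTop (𝓝 l)) :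
    ∃ X : Ω → Space E, Measurable X ∧ (∀ ω, T (X ω) = X ω) ∧ ∀ᵐ ω ∂P,
      ∀ y, Tendsto (fun k => inner ℝ (x k ω) y) atTop (𝓝 (inner ℝ (X ω) y)) := by
  classical
  have : ∀ i, SecondCountableTopology (E i) := fun i => UniformSpace.secondCountable_of_separable _
  obtain ⟨G, hGP, hGm, hG⟩ := hfejer.exists_measurable_mem
  choose! X hXfix hXlim using fun ω (hω : ω ∈ G) =>
    (exists_weak_limit_of_fejer hT hfix (hG ω hω).1 (hG ω hω).2).2
  obtain ⟨a, ha⟩ := hfix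
  -- The chosen `X` has no measurability by itself; on the measurable set `G` its inner products are
  -- limits of measurable functions, and off `G` a constant fixed point replaces it.
  refine ⟨G.piecewise X fun _ => a, measurable_of_inner fun y => ?_, fun ω => ?_, ?_⟩
  · refine measurable_of_tendsto_metrizable
      (f := fun k => G.piecewise (fun ω => inner ℝ (x k ω) y) fun _ => inner ℝ a y)
      (fun k => ?_) (tendsto_pi_nhds.2 fun ω => ?_)
    · exact ((continuous_id.inner (continuous_const (y := y))).measurable.comp
        (hrun.measurable_iterate k)).piecewise hGm measurable_const
    · by_cases h : ω ∈ G
      · simpa [h] using hXlim ω h y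
      · simp [h]
  · by_cases h : ω ∈ G
    · simpa [h] using hXfix ω h
    · simpa [h] using ha
  · filter_upwards [hGP] with ω h
    simpa [h] using hXlim ω h

end Convergence

end ARock

/-! ### The main theorem. -/

theorem theorem3p3 {m : ℕ} {E : Fin m → Type*}
    [∀ i, NormedAddCommGroup (E i)] [∀ i, InnerProductSpace ℝ (E i)]
    [∀ i, CompleteSpace (E i)] [∀ i, TopologicalSpace.SeparableSpace (E i)]
    [∀ i, MeasurableSpace (E i)] [∀ i, BorelSpace (E i)]
    {Ω : Type*} [MeasurableSpace Ω] (P : Measure Ω) [IsProbabilityMeasure P]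
    (T : ARock.Space E → ARock.Space E)
    (hT : LipschitzWith 1 T) (hfix : ∃ xs, T xs = xs)
    (p : Fin m → ℝ) (hp : ∀ i, 0 < p i) (hp_sum : ∑ i, p i = 1)
    (τ : ℕ) (c ηmin : ℝ) (hc0 : 0 < c) (hc1 : c < 1) (hηmin : 0 < ηmin)
    (η : ℕ → ℝ)
    (hη : ∀ k, η k ∈ Set.Icc ηmin
      (c * (m : ℝ) * ARock.pmin p / (2 * (τ : ℝ) * Real.sqrt (ARock.pmin p) + 1)))
    (idx : ℕ → Ω → Fin m) (x xhat : ℕ → Ω → ARock.Space E)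
    (hrun : ARock.IsRun T p η τ P idx x xhat) :
    (∃ X : Ω → ARock.Stack (ARock.Space E) τ, Measurable X ∧
      (∀ ω, X ω ∈ ARock.diagFix T τ) ∧
      ∀ᵐ ω ∂P, ARock.WeaklyTendsto (fun k => ARock.stack τ (fun n => x n ω) k) (X ω)) ∧
    (ARock.DemicompactAt T 0 →
      ∃ X : Ω → ARock.Stack (ARock.Space E) τ, Measurable X ∧
        (∀ ω, X ω ∈ ARock.diagFix T τ) ∧
        ∀ᵐ ω ∂P, Tendsto (fun k => ARock.stack τ (fun n => x n ω) k) atTop (𝓝 (X ω))) := by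

  have : Nonempty (Fin m) := by
    by_contra h
    rw [not_nonempty_iff] at h
    simp at hp_sum
  have hm : (0 : ℝ) < m := by exact_mod_cast Fin.pos_iff_nonempty.2 this
  have hpm := ARock.pmin_pos hp
  -- With `r² = p_min`, the condition `η k / m * (2 * τ * r + 1) ≤ c * r²` is exactly the upper
  -- step-size bound.
  set r := Real.sqrt (ARock.pmin p) with hr_def
  have hr : 0 < r := Real.sqrt_pos.2 hpm
  have hr2 : r ^ 2 = ARock.pmin p := Real.sq_sqrt hpm.le
  have hfejer := hrun.ae_fejer hT hfix hp hp_sum hr (fun i => hr2.trans_le (ARock.pmin_le p i)) hc1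
    (div_pos hηmin hm) (fun k => by gcongr; exact (hη k).1) fun k => by
      have h1 := (le_div_iff₀ (by positivity)).1 (hη k).2
      rw [hr2, div_mul_eq_mul_div, div_le_iff₀ hm]
      linarith
  obtain ⟨X, hXm, hXfix, hX⟩ := hrun.exists_ae_weak_limit hT hfix hfejer
  have hXm' : Measurable fun ω => (WithLp.toLp 2 fun _ => X ω : ARock.Stack (ARock.Space E) τ) :=
    (WithLp.measurable_toLp 2 _).comp (measurable_pi_lambda _ fun _ => hXm)
  refine ⟨⟨_, hXm', fun ω => ⟨X ω, hXfix ω, fun _ => rfl⟩, ?_⟩,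
    fun hdemi => ⟨_, hXm', fun ω => ⟨X ω, hXfix ω, fun _ => rfl⟩, ?_⟩⟩
  · filter_upwards [hX] with ω hω
    exact ARock.weaklyTendsto_stack τ hω
  · filter_upwards [hX, hfejer] with ω hω hfω
    obtain ⟨C, hC⟩ := (ARock.exists_weak_limit_of_fejer hT hfix hfω.1 hfω.2).1
    exact ARock.tendsto_stack τ
      (ARock.tendsto_of_weak_limit_of_demicompactAt hdemi hC hfω.1 hfω.2 (hXfix ω) hω)
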